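/- Let $\Lambda$ and $\Gamma$ be countable discrete groups. Consider standard Borel spaces $\Sigma$ with a nonzero $\sigma$-finite measure $\mu$ (of finite or infinite total mass) and a measurable, measure preserving action of $\Lambda\times\Gamma$. A fundamental domain for one of the groups is a measurable set whose translates under that group are pairwise disjoint and cover $\Sigma$, up to null sets. Call $(\Sigma,\mu)$ an \emph{MI-coupling} if $\Lambda$ admits a fundamental domain $Y$ and $\Gamma$ admits a fundamental domain $X$ with $\mu(X)<\infty$; its \emph{index} is $\mu(Y)/\mu(X)\in(0,\infty]$, which does not depend on the choice of $X$ and $Y$. Say that $\Lambda$ \emph{measurably imbeds} (MI) into $\Gamma$ with index $c$ if there is an MI-coupling of index $c$, and that $\Lambda$ \emph{strictly measurably imbeds} (SMI) into $\Gamma$ if there is such a space $(\Sigma,\mu)$ with Borel fundamental domains $Y$ for $\Lambda$ and $X$ for $\Gamma$ satisfying $\mu(X)<\infty$ and $X\subset Y$. Proposition. $\Lambda$ strictly measurably imbeds into $\Gamma$ if and only if $\Lambda$ measurably imbeds into $\Gamma$ with some index $c\ge 1$ ($c=\infty$ allowed). -/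

import Mathlib

open MeasureTheory
open scoped ENNReal

universe u v

/-- A standard (standard Borel, nonzero, `σ`-finite) measure space `(Σ, μ)` with a measurable,
measure preserving action of `Λ × Γ`. An action of `Λ × Γ` is given by its restrictions to the
two factors, i.e. by a pair of commuting actions of `Λ` and `Γ`; as the groups are discrete,
measurability of the action means that every group element acts by a measurable map. The total
measure may be finite or infinite (it is finite for couplings of finite groups). -/
structure BiactionSpace (Λ : Type u) (Γ : Type v) [Group Λ] [Group Γ] where
  carrier : Type
  [measurableSpace : MeasurableSpace carrier]
  [standardBorelSpace : StandardBorelSpace carrier]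
  [leftAction : MulAction Λ carrier]
  [rightAction : MulAction Γ carrier]
  [smulCommClass : SMulCommClass Λ Γ carrier]
  [measurableLeft : MeasurableConstSMul Λ carrier]
  [measurableRight : MeasurableConstSMul Γ carrier]
  μ : Measure carrier
  [sigmaFinite : SigmaFinite μ]
  [neZero : NeZero μ]
  [invariantLeft : SMulInvariantMeasure Λ carrier μ]
  [invariantRight : SMulInvariantMeasure Γ carrier μ]

namespace BiactionSpace

attribute [instance] measurableSpace standardBorelSpace leftAction rightAction smulCommClass
  measurableLeft measurableRight sigmaFinite neZero invariantLeft invariantRight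

variable {Λ : Type u} {Γ : Type v} [Group Λ] [Group Γ]

/-- `(Σ, μ)` is an MI-coupling: `Λ` has a fundamental domain `Y` (of arbitrary measure) and `Γ` has
a fundamental domain `X` of finite measure. Here `IsFundamentalDomain G D μ` says that `D` is
`μ`-measurable and `Σ` is, modulo `μ`-null sets, the disjoint union of the translates `g • D`. -/
def IsMICoupling (S : BiactionSpace Λ Γ) : Prop :=
  ∃ Y X : Set S.carrier, IsFundamentalDomain Λ Y S.μ ∧ IsFundamentalDomain Γ X S.μ ∧ S.μ X < ∞

/-- `(Σ, μ)` is an SMI-coupling: there are Borel fundamental domains `Y` for `Λ` and `X` for `Γ`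
such that `X` has finite measure and `X ⊆ Y`. -/
def IsSMICoupling (S : BiactionSpace Λ Γ) : Prop :=
  ∃ Y X : Set S.carrier, MeasurableSet Y ∧ MeasurableSet X ∧
    IsFundamentalDomain Λ Y S.μ ∧ IsFundamentalDomain Γ X S.μ ∧ S.μ X < ∞ ∧ X ⊆ Y

/-- The index `[Γ : Λ]_Σ = μ(Y) / μ(X)` of a coupling. The covolume of an action is the measure of
a fundamental domain; see `index_eq` for the independence of the choice. -/
noncomputable def index (S : BiactionSpace Λ Γ) : ℝ≥0∞ :=
  covolume Λ S.carrier S.μ / covolume Γ S.carrier S.μ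

/-- The index is the ratio `μ(Y) / μ(X)` for any choice of the fundamental domains. -/
theorem index_eq [Countable Λ] [Countable Γ] (S : BiactionSpace Λ Γ) {Y X : Set S.carrier}
    (hY : IsFundamentalDomain Λ Y S.μ) (hX : IsFundamentalDomain Γ X S.μ) :
    S.index = S.μ Y / S.μ X := by
  rw [index, hY.covolume_eq_volume, hX.covolume_eq_volume]

end BiactionSpace

/-- `Λ` strictly measurably imbeds into `Γ`. -/
def StrictlyMeasurablyImbeds (Λ : Type u) (Γ : Type v) [Group Λ] [Group Γ] : Prop :=
  ∃ S : BiactionSpace Λ Γ, S.IsSMICoupling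

/-- `Λ` measurably imbeds into `Γ` with index `c`: some MI-coupling has index `c`. -/
def MeasurablyImbedsWithIndex (Λ : Type u) (Γ : Type v) [Group Λ] [Group Γ] (c : ℝ≥0∞) : Prop :=
  ∃ S : BiactionSpace Λ Γ, S.IsMICoupling ∧ S.index = c

open scoped Pointwise

/-! If `X ⊆ Y`, monotonicity of `μ` gives index at least 1. Conversely, let `μ X ≤ μ Y` and greedily
move pieces of `X` into `Y` by elements `(l, c)` of the countable group `Λ × Γ`. If this exhausts
`X` up to a null set, replacing each piece `A` by `c • A` and its image `l • c • A` by `l⁻¹ • l • c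
• A = c • A` turns `X` and `Y` into nested fundamental domains (`isSMICoupling_of_matching`).

Without ergodicity a part `R` of `X` may stay unmatched. By maximality its saturation misses the
unmatched part of `Y`. Were the saturation conull, `Y` would be matched almost entirely, and `μ X ≤
μ Y`, `μ X < ∞` would force `R`, hence `μ`, to vanish. So the complement of the saturation is a
nonnull invariant set, and restricting `μ` to it makes `R` null. -/

/-- The parts of `X` and `Y` that are still unmatched at stage `n` of the greedy matching, which at
stage `n` matches by `T n` every unmatched point of `X` that `T n` sends to an unmatched point of
`Y`. -/
def greedyRemainder {α : Type*} (T : ℕ → α → α) (X Y : Set α) : ℕ → Set α × Set α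
  | 0 => (X, Y)
  | n + 1 =>
    let R := (greedyRemainder T X Y n).1
    let Q := (greedyRemainder T X Y n).2
    (R \ (R ∩ T n ⁻¹' Q), Q \ T n '' (R ∩ T n ⁻¹' Q))

/-- Given countably many automorphisms `T n`, a part of `X` is matched piecewise with a part of `Y`
in such a way that no `T n` sends an unmatched point of `X` to an unmatched point of `Y`. -/
theorem exists_greedy_matching {α : Type*} [MeasurableSpace α] (T : ℕ → α ≃ᵐ α) {X Y : Set α}
    (hX : MeasurableSet X) (hY : MeasurableSet Y) :
    ∃ A : ℕ → Set α, (∀ n, MeasurableSet (A n)) ∧ (∀ n, A n ⊆ X) ∧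
      Pairwise (fun m n => Disjoint (A m) (A n)) ∧ (∀ n, T n '' A n ⊆ Y) ∧
      Pairwise (fun m n => Disjoint (T m '' A m) (T n '' A n)) ∧
      ∀ n, ∀ x ∈ X \ ⋃ k, A k, T n x ∉ Y \ ⋃ k, T k '' A k := by
  set P := greedyRemainder (fun n => T n) X Y with hP
  let A : ℕ → Set α := fun n => (P n).1 ∩ T n ⁻¹' (P n).2
  have hsucc : ∀ n, P (n + 1) = ((P n).1 \ A n, (P n).2 \ T n '' A n) := fun n => rfl
  have hmeas : ∀ n, MeasurableSet (P n).1 ∧ MeasurableSet (P n).2 := by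
    intro n
    induction n with
    | zero => exact ⟨hX, hY⟩
    | succ n ih =>
      have hA : MeasurableSet (A n) := ih.1.inter ((T n).measurable ih.2)
      rw [hsucc]
      exact ⟨ih.1.diff hA, ih.2.diff ((T n).measurableSet_image.2 hA)⟩
  have hanti1 : Antitone fun n => (P n).1 :=
    antitone_nat_of_succ_le fun n => by simp only [hsucc]; exact Set.sdiff_subset
  have hanti2 : Antitone fun n => (P n).2 :=
    antitone_nat_of_succ_le fun n => by simp only [hsucc]; exact Set.sdiff_subset
  have himg : ∀ n, T n '' A n ⊆ (P n).2 := by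
    rintro n _ ⟨x, hx, rfl⟩
    exact hx.2
  have hmem1 : ∀ x ∈ X \ ⋃ k, A k, ∀ n, x ∈ (P n).1 := by
    rintro x ⟨hx, hxA⟩ n
    induction n with
    | zero => exact hx
    | succ n ih => rw [hsucc]; exact ⟨ih, fun h => hxA (Set.mem_iUnion.2 ⟨n, h⟩)⟩
  have hmem2 : ∀ y ∈ Y \ ⋃ k, T k '' A k, ∀ n, y ∈ (P n).2 := by
    rintro y ⟨hy, hyA⟩ n
    induction n with
    | zero => exact hy
    | succ n ih => rw [hsucc]; exact ⟨ih, fun h => hyA (Set.mem_iUnion.2 ⟨n, h⟩)⟩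
  refine ⟨A, fun n => (hmeas n).1.inter ((T n).measurable (hmeas n).2),
    fun n => Set.inter_subset_left.trans (hanti1 (Nat.zero_le n)), ?_,
    fun n => (himg n).trans (hanti2 (Nat.zero_le n)), ?_, ?_⟩
  · refine (pairwise_disjoint_on A).2 fun m n hmn => Set.disjoint_left.2 fun x hm hn => ?_
    have h : x ∈ (P (m + 1)).1 := hanti1 (Nat.succ_le_of_lt hmn) hn.1
    rw [hsucc] at h
    exact h.2 hm
  · refine (pairwise_disjoint_on fun n => T n '' A n).2 fun m n hmn =>
      Set.disjoint_left.2 fun x hm hn => ?_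
    have h : x ∈ (P (m + 1)).2 := hanti2 (Nat.succ_le_of_lt hmn) (himg n hn)
    rw [hsucc] at h
    exact h.2 hm
  · intro n x hx hy
    exact hx.2 (Set.mem_iUnion.2 ⟨n, hmem1 x hx n, hmem2 _ hy n⟩)

/-! ### Fundamental domains and invariant measures -/

/-- Translating the pieces of a countable partition of a fundamental domain yields a fundamental
domain. -/
theorem MeasureTheory.IsFundamentalDomain.iUnion_smul {G α ι : Type*} [Group G] [MulAction G α]
    [MeasurableSpace α] [MeasurableConstSMul G α] {μ : Measure α} [SMulInvariantMeasure G α μ]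
    [Countable ι] {D : Set α} (hD : IsFundamentalDomain G D μ) {F : ι → Set α}
    (hF : ∀ i, MeasurableSet (F i)) (hFD : ∀ i, F i ⊆ D)
    (hdisj : Pairwise fun i j => Disjoint (F i) (F j)) (hcover : μ (D \ ⋃ i, F i) = 0)
    [Countable G] (g : ι → G) : IsFundamentalDomain G (⋃ i, g i • F i) μ where
  nullMeasurableSet :=
    (MeasurableSet.iUnion fun i => (hF i).const_smul (g i)).nullMeasurableSet
  ae_covers := by
    have hnull : ∀ᵐ x ∂μ, ∀ h : G, h • x ∉ D \ ⋃ i, F i := by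
      refine ae_all_iff.2 fun h => ?_
      rw [ae_iff]
      simp only [not_not]
      exact measure_preimage_smul_null hcover h
    filter_upwards [hD.ae_covers, hnull] with x ⟨h, hx⟩ hn
    have hxF : h • x ∈ ⋃ i, F i := by
      by_contra hc
      exact hn h ⟨hx, hc⟩
    obtain ⟨i, hi⟩ := Set.mem_iUnion.1 hxF
    exact ⟨g i * h, Set.mem_iUnion.2 ⟨i, by rw [mul_smul]; exact Set.smul_mem_smul_set hi⟩⟩
  aedisjoint := by
    intro a b hab
    simp only [Function.onFun, Set.smul_set_iUnion, AEDisjoint.iUnion_left_iff,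
      AEDisjoint.iUnion_right_iff]
    intro j i
    rw [smul_smul, smul_smul]
    -- Either both pieces are moved by the same element, and their disjointness decides, or they lie
    -- in distinct translates of `D`.
    by_cases h : a * g i = b * g j
    · have hij : i ≠ j := by
        rintro rfl
        exact hab (mul_right_cancel h)
      rw [h]
      exact ((Set.disjoint_smul_set).2 (hdisj hij)).aedisjoint
    · exact AEDisjoint.mono (hD.aedisjoint h) (Set.smul_set_mono (hFD i)) (Set.smul_set_mono (hFD j))

/-- A fundamental domain contains a measurable one. -/
theorem MeasureTheory.IsFundamentalDomain.exists_measurableSet {G α : Type*} [Group G]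
    [MulAction G α] [MeasurableSpace α] [MeasurableConstSMul G α] {μ : Measure α}
    [SMulInvariantMeasure G α μ] [Countable G] {D : Set α} (hD : IsFundamentalDomain G D μ) :
    ∃ E ⊆ D, MeasurableSet E ∧ μ E = μ D ∧ IsFundamentalDomain G E μ := by
  obtain ⟨E, hED, hE, hae⟩ := hD.nullMeasurableSet.exists_measurable_subset_ae_eq
  refine ⟨E, hED, hE, measure_congr hae, ?_⟩
  have := hD.iUnion_smul (ι := Unit) (F := fun _ => E) (fun _ => hE) (fun _ => hED)
    (fun i j h => (h rfl).elim) (by rw [Set.iUnion_const]; exact ae_le_set.1 hae.symm.le) (fun _ => 1)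
  simpa only [one_smul, Set.iUnion_const] using this

/-- An invariant measure restricted to an invariant set is invariant. -/
theorem MeasureTheory.SMulInvariantMeasure.restrict_of_preimage_eq {G α : Type*} [Group G]
    [MulAction G α] [MeasurableSpace α] [MeasurableConstSMul G α] {μ : Measure α}
    [SMulInvariantMeasure G α μ] {W : Set α} (hW : MeasurableSet W)
    (hinv : ∀ g : G, (g • ·) ⁻¹' W = W) : SMulInvariantMeasure G α (μ.restrict W) where
  measure_preimage_smul g s hs := by
    rw [Measure.restrict_apply ((measurable_const_smul g) hs), Measure.restrict_apply hs]
    conv_lhs => rw [← hinv g]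
    rw [← Set.preimage_inter]
    exact measure_preimage_smul_of_nullMeasurableSet (hs.inter hW).nullMeasurableSet g

/-! ### Matching fundamental domains inside a coupling -/

namespace BiactionSpace

variable {Λ : Type u} {Γ : Type v} [Group Λ] [Group Γ]

/-- The action of an element of `Λ × Γ`. -/
noncomputable def actEquiv (S : BiactionSpace Λ Γ) (p : Λ × Γ) : S.carrier ≃ᵐ S.carrier :=
  (MeasurableEquiv.smul p.2).trans (MeasurableEquiv.smul p.1)

theorem actEquiv_apply (S : BiactionSpace Λ Γ) (p : Λ × Γ) (x : S.carrier) :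
    S.actEquiv p x = p.1 • p.2 • x := rfl

theorem actEquiv_image (S : BiactionSpace Λ Γ) (p : Λ × Γ) (A : Set S.carrier) :
    S.actEquiv p '' A = p.1 • p.2 • A := by
  rw [← Set.image_smul, ← Set.image_smul, Set.image_image]
  rfl

theorem measure_actEquiv_image (S : BiactionSpace Λ Γ) (p : Λ × Γ) (A : Set S.carrier) :
    S.μ (S.actEquiv p '' A) = S.μ A := by
  rw [actEquiv_image, measure_smul, measure_smul]

/-- The saturation of a set under `Λ × Γ`. -/
def saturation (S : BiactionSpace Λ Γ) (A : Set S.carrier) : Set S.carrier :=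
  ⋃ p : Λ × Γ, S.actEquiv p '' A

theorem mem_saturation {S : BiactionSpace Λ Γ} {A : Set S.carrier} {x : S.carrier} :
    x ∈ S.saturation A ↔ ∃ (l : Λ) (c : Γ), l • c • x ∈ A := by
  simp only [saturation, Set.mem_iUnion, Set.mem_image, actEquiv_apply, Prod.exists]
  constructor
  · rintro ⟨l, c, a, ha, rfl⟩
    exact ⟨l⁻¹, c⁻¹, by rwa [← smul_comm l c⁻¹, inv_smul_smul, inv_smul_smul]⟩
  · rintro ⟨l, c, h⟩
    exact ⟨l⁻¹, c⁻¹, _, h, by rw [← smul_comm l c⁻¹, inv_smul_smul, inv_smul_smul]⟩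

theorem preimage_left_saturation (S : BiactionSpace Λ Γ) (A : Set S.carrier) (g : Λ) :
    (g • ·) ⁻¹' S.saturation A = S.saturation A := by
  ext x
  simp only [Set.mem_preimage, mem_saturation]
  constructor
  · rintro ⟨l, c, h⟩
    exact ⟨l * g, c, by rwa [mul_smul, smul_comm g c]⟩
  · rintro ⟨l, c, h⟩
    exact ⟨l * g⁻¹, c, by rwa [mul_smul, smul_comm g⁻¹ c, inv_smul_smul]⟩

theorem preimage_right_saturation (S : BiactionSpace Λ Γ) (A : Set S.carrier) (g : Γ) :
    (g • ·) ⁻¹' S.saturation A = S.saturation A := by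
  ext x
  simp only [Set.mem_preimage, mem_saturation]
  constructor
  · rintro ⟨l, c, h⟩
    exact ⟨l, c * g, by rwa [mul_smul]⟩
  · rintro ⟨l, c, h⟩
    exact ⟨l, c * g⁻¹, by rwa [mul_smul, inv_smul_smul]⟩

/-- The restriction of the measure to a nonnull invariant set. -/
noncomputable def restrict (S : BiactionSpace Λ Γ) (W : Set S.carrier) (hW : MeasurableSet W)
    (hl : ∀ g : Λ, (g • ·) ⁻¹' W = W) (hr : ∀ g : Γ, (g • ·) ⁻¹' W = W) (h0 : S.μ W ≠ 0) :
    BiactionSpace Λ Γ where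
  carrier := S.carrier
  μ := S.μ.restrict W
  neZero := ⟨fun h => h0 (Measure.restrict_eq_zero.1 h)⟩
  invariantLeft := SMulInvariantMeasure.restrict_of_preimage_eq hW hl
  invariantRight := SMulInvariantMeasure.restrict_of_preimage_eq hW hr

/-- If the fundamental domain `X` of `Γ` is, up to a null set, matched piecewise under `Λ × Γ` with
a part of the fundamental domain `Y` of `Λ`, then the coupling is strict. -/
theorem isSMICoupling_of_matching [Countable Λ] [Countable Γ] (S : BiactionSpace Λ Γ)
    {Y X : Set S.carrier} (hYm : MeasurableSet Y) (hY : IsFundamentalDomain Λ Y S.μ)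
    (hX : IsFundamentalDomain Γ X S.μ) (hfin : S.μ X < ∞) (e : ℕ → Λ × Γ) (A : ℕ → Set S.carrier)
    (hA : ∀ n, MeasurableSet (A n)) (hAX : ∀ n, A n ⊆ X)
    (hAd : Pairwise fun m n => Disjoint (A m) (A n)) (hAY : ∀ n, S.actEquiv (e n) '' A n ⊆ Y)
    (hBd : Pairwise fun m n => Disjoint (S.actEquiv (e m) '' A m) (S.actEquiv (e n) '' A n))
    (hcover : S.μ (X \ ⋃ n, A n) = 0) : S.IsSMICoupling := by
  have hBm : ∀ n, MeasurableSet (S.actEquiv (e n) '' A n) := fun n =>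
    (S.actEquiv (e n)).measurableSet_image.2 (hA n)
  -- The index `none` carries the unmatched part of `Y`, which stays in place; the `n`-th image is
  -- pulled back by its `Λ`-component only, landing on the `Γ`-translate of `A n`.
  let F : Option ℕ → Set S.carrier := fun i =>
    i.elim (Y \ ⋃ n, S.actEquiv (e n) '' A n) fun n => S.actEquiv (e n) '' A n
  let g : Option ℕ → Λ := fun i => i.elim 1 fun n => (e n).1⁻¹
  have hFm : ∀ i, MeasurableSet (F i) := by
    rintro (_ | n)
    · exact hYm.diff (MeasurableSet.iUnion hBm)
    · exact hBm n
  have hFY : ∀ i, F i ⊆ Y := by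
    rintro (_ | n)
    · exact Set.sdiff_subset
    · exact hAY n
  have hnone : ∀ n, Disjoint (F none) (F (some n)) := fun n =>
    Set.disjoint_left.2 fun x hx hn => hx.2 (Set.mem_iUnion.2 ⟨n, hn⟩)
  have hFd : Pairwise fun i j => Disjoint (F i) (F j) := by
    rintro (_ | m) (_ | n) h
    · exact (h rfl).elim
    · exact hnone n
    · exact (hnone m).symm
    · exact hBd fun hmn => h (congrArg some hmn)
  have hFc : S.μ (Y \ ⋃ i, F i) = 0 := by
    have : Y \ ⋃ i, F i = ∅ := by
      refine Set.sdiff_eq_empty.2 fun y hy => ?_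
      by_cases hyB : y ∈ ⋃ n, S.actEquiv (e n) '' A n
      · obtain ⟨n, hn⟩ := Set.mem_iUnion.1 hyB
        exact Set.mem_iUnion.2 ⟨some n, hn⟩
      · exact Set.mem_iUnion.2 ⟨none, hy, hyB⟩
    rw [this, measure_empty]
  have hX' : IsFundamentalDomain Γ (⋃ n, (e n).2 • A n) S.μ :=
    hX.iUnion_smul hA hAX hAd hcover _
  refine ⟨⋃ i, g i • F i, ⋃ n, (e n).2 • A n,
    MeasurableSet.iUnion fun i => (hFm i).const_smul (g i),
    MeasurableSet.iUnion fun n => (hA n).const_smul _,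
    hY.iUnion_smul hFm hFY hFd hFc g, hX', ?_, ?_⟩
  · rwa [hX'.measure_eq hX]
  · refine Set.iUnion_subset fun n => ?_
    have : (e n).2 • A n = g (some n) • F (some n) := by
      change _ = (e n).1⁻¹ • (S.actEquiv (e n) '' A n)
      rw [actEquiv_image, inv_smul_smul]
    rw [this]
    exact Set.subset_iUnion (fun i => g i • F i) (some n)

/-- If the fundamental domain of `Γ` is not larger than that of `Λ`, then the restriction of the
coupling to some invariant set is strict. -/
theorem strictlyMeasurablyImbeds_of_measure_le [Countable Λ] [Countable Γ]
    (S : BiactionSpace Λ Γ) {Y X : Set S.carrier} (hYm : MeasurableSet Y) (hXm : MeasurableSet X)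
    (hY : IsFundamentalDomain Λ Y S.μ) (hX : IsFundamentalDomain Γ X S.μ) (hfin : S.μ X < ∞)
    (hle : S.μ X ≤ S.μ Y) : StrictlyMeasurablyImbeds Λ Γ := by
  obtain ⟨e, he⟩ := exists_surjective_nat (Λ × Γ)
  obtain ⟨A, hA, hAX, hAd, hAY, hBd, hmax⟩ :=
    exists_greedy_matching (fun n => S.actEquiv (e n)) hXm hYm
  set R := X \ ⋃ n, A n with hR
  have hRm : MeasurableSet R := hXm.diff (MeasurableSet.iUnion hA)
  have hsat : MeasurableSet (S.saturation R) :=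
    MeasurableSet.iUnion fun p => (S.actEquiv p).measurableSet_image.2 hRm
  have hRsat : R ⊆ S.saturation R := fun x hx =>
    mem_saturation.2 ⟨1, 1, by rwa [one_smul, one_smul]⟩
  have hW : S.μ (S.saturation R)ᶜ ≠ 0 := by
    intro h0
    -- By maximality of the matching, no translate of `R` meets the unmatched part of `Y`.
    have hQ : S.μ (Y \ ⋃ n, S.actEquiv (e n) '' A n) = 0 := by
      refine measure_mono_null (t := (S.saturation R)ᶜ) (fun y hy hys => ?_) h0
      obtain ⟨p, x, hx, rfl⟩ := Set.mem_iUnion.1 hys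
      obtain ⟨n, rfl⟩ := he p
      exact hmax n x hx hy
    have hYA : S.μ Y ≤ S.μ (⋃ n, A n) := by
      calc S.μ Y ≤ S.μ (⋃ n, S.actEquiv (e n) '' A n) := measure_mono_ae (ae_le_set.2 hQ)
        _ ≤ ∑' n, S.μ (S.actEquiv (e n) '' A n) := measure_iUnion_le _
        _ = ∑' n, S.μ (A n) := by simp only [measure_actEquiv_image]
        _ = S.μ (⋃ n, A n) := (measure_iUnion hAd hA).symm
    have hAX' : (⋃ n, A n) ⊆ X := Set.iUnion_subset hAX
    have hR0 : S.μ R = 0 := by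
      rw [hR, measure_sdiff hAX' (MeasurableSet.iUnion hA).nullMeasurableSet
        ((measure_mono hAX').trans_lt hfin).ne]
      exact tsub_eq_zero_of_le (hle.trans hYA)
    have hsat0 : S.μ (S.saturation R) = 0 :=
      measure_iUnion_null fun p => by rw [measure_actEquiv_image, hR0]
    refine NeZero.ne S.μ (Measure.measure_univ_eq_zero.1 ?_)
    rw [← Set.union_compl_self (S.saturation R)]
    exact measure_union_null hsat0 h0
  let S' := S.restrict (S.saturation R)ᶜ hsat.compl
    (fun g => by rw [Set.preimage_compl, S.preimage_left_saturation])
    (fun g => by rw [Set.preimage_compl, S.preimage_right_saturation]) hW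
  have hac : S.μ.restrict (S.saturation R)ᶜ ≪ S.μ := Measure.restrict_le_self.absolutelyContinuous
  -- The same sets and matching serve for the restricted measure, which does not charge `R`.
  refine ⟨S', S'.isSMICoupling_of_matching (Y := Y) (X := X) hYm (hY.mono hac) (hX.mono hac)
    ((Measure.restrict_le_self X).trans_lt hfin) e A hA hAX hAd hAY hBd ?_⟩
  change S.μ.restrict (S.saturation R)ᶜ R = 0
  rw [Measure.restrict_apply hRm, ← Set.sdiff_eq, Set.sdiff_eq_empty.2 hRsat, measure_empty]

end BiactionSpace

theorem mainTheorem7 (Λ : Type u) (Γ : Type v) [Group Λ] [Group Γ] [Countable Λ] [Countable Γ] :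
    StrictlyMeasurablyImbeds Λ Γ ↔ ∃ c : ℝ≥0∞, 1 ≤ c ∧ MeasurablyImbedsWithIndex Λ Γ c := by
  constructor
  · rintro ⟨S, Y, X, -, -, hY, hX, hfin, hXY⟩
    refine ⟨S.index, ?_, S, ⟨Y, X, hY, hX, hfin⟩, rfl⟩
    -- Countably many translates of `X` cover almost everything, so a null `X` would give `μ = 0`.
    have hX0 : S.μ X ≠ 0 := hX.measure_ne_zero (NeZero.ne S.μ)
    rw [S.index_eq hY hX, ENNReal.le_div_iff_mul_le (Or.inl hX0) (Or.inl hfin.ne), one_mul]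
    exact measure_mono hXY
  · rintro ⟨c, hc, S, ⟨Y, X, hY, hX, hfin⟩, rfl⟩
    have hX0 : S.μ X ≠ 0 := hX.measure_ne_zero (NeZero.ne S.μ)
    rw [S.index_eq hY hX, ENNReal.le_div_iff_mul_le (Or.inl hX0) (Or.inl hfin.ne), one_mul] at hc
    -- The given domains are only null measurable, while the greedy matching needs measurable sets.
    obtain ⟨Y', -, hYm, hYY, hY'⟩ := hY.exists_measurableSet
    obtain ⟨X', -, hXm, hXX, hX'⟩ := hX.exists_measurableSet
    exact S.strictlyMeasurablyImbeds_of_measure_le hYm hXm hY' hX' (hXX ▸ hfin)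
      (by rwa [hXX, hYY])
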